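/- Let $k$ be an algebraically closed field of characteristic $p>5$, and let $W_1=\mathrm{Der}_k\big(k[X]/(X^p)\big)$ be the Witt algebra, with the commutator bracket and with $[p]$-map given by $x^{[p]}=x^p$ ($p$-fold composition of derivations). Let $D$ be the derivation of $k[X]/(X^p)$ induced by $d/dX$, and for $i\ge 0$ let $\mathfrak g_i=\mathrm{span}_k\{X^{j+1}D : i\le j\le p-2\}$. Let $\mathscr B^+=\mathfrak g_0$ be the standard Borel subalgebra and $\mathcal N(\mathscr B^+)=\{x\in\mathscr B^+ : x^{[p]}=0\}$ its nilpotent variety. Then $\mathcal N(\mathscr B^+)=\mathfrak g_1$, and the nilpotent commuting variety $$\mathcal C(\mathfrak g_1)=\{(x,y)\in\mathfrak g_1\times\mathfrak g_1 : [x,y]=0\}$$ of $\mathscr B^+$, regarded as a (reduced) closed subvariety of the affine space $\mathfrak g_1\times\mathfrak g_1$, is not normal, i.e. not all of its local rings are integrally closed domains. Moreover, $\mathcal C(\mathfrak g_1)$ has at least two irreducible components, and all of its irreducible components contain the point $(0,0)$. -/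

import Mathlib

open Polynomial

noncomputable section

/-! # Affine varieties inside a finite-dimensional vector space -/

section Varieties

variable (k : Type*) [Field k] {V : Type*} [AddCommGroup V] [Module k V]

/-- The coordinate ring `k[Z]` of a (Zariski closed) subset `Z` of a finite-dimensional
`k`-vector space `V`: the `k`-algebra of functions on `Z` that are restrictions of polynomial
functions on `V`, i.e. the algebra generated by the restrictions of the linear forms on `V`. -/
def coordinateRing (Z : Set V) : Subalgebra k (Z → k) :=
  Algebra.adjoin k (Set.range fun φ : Module.Dual k V => fun z : Z => φ (z : V))

/-- Evaluation of regular functions at a point of `Z`. -/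
def evalAt (Z : Set V) (z : Z) : coordinateRing k Z →ₐ[k] k :=
  (Pi.evalAlgHom k (fun _ : Z => k) z).comp (coordinateRing k Z).val

/-- The maximal ideal of the regular functions on `Z` that vanish at the point `z`. -/
def pointIdeal (Z : Set V) (z : Z) : Ideal (coordinateRing k Z) :=
  RingHom.ker (evalAt k Z z)

instance pointIdeal_isPrime (Z : Set V) (z : Z) : (pointIdeal k Z z).IsPrime :=
  RingHom.ker_isPrime _

/-- The local ring of the variety `Z` at the point `z`. -/
abbrev localRingAt (Z : Set V) (z : Z) : Type _ :=
  Localization.AtPrime (pointIdeal k Z z)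

/-- `Z` is a normal variety: the local ring at each point is an integrally closed domain. -/
def IsNormalVariety (Z : Set V) : Prop :=
  ∀ z : Z, IsDomain (localRingAt k Z z) ∧ IsIntegrallyClosed (localRingAt k Z z)

/-- The Zariski topology on `Z`: the sets where a regular function does not vanish form a basis
of open sets. -/
@[reducible]
def zariskiTopology (Z : Set V) : TopologicalSpace Z :=
  TopologicalSpace.generateFrom {U | ∃ f ∈ coordinateRing k Z, U = {z : Z | f z ≠ 0}}

/-- The irreducible components of `Z` for its Zariski topology. -/
def zariskiComponents (Z : Set V) : Set (Set Z) :=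
  @irreducibleComponents Z (zariskiTopology k Z)

end Varieties

/-! # The Witt algebra -/

namespace WittAlg

variable (k : Type*) [Field k] (p : ℕ)

/-- The truncated polynomial algebra `k[X]/(X^p)`. -/
abbrev TruncPoly : Type _ := k[X] ⧸ Ideal.span {(X : k[X]) ^ p}

/-- The coset of `X`. -/
def x : TruncPoly k p := Ideal.Quotient.mk _ X

/-- The Witt algebra `W_1`: the Lie algebra of all `k`-linear derivations of `k[X]/(X^p)`, with
the commutator bracket. -/
abbrev W1 : Type _ := Derivation k (TruncPoly k p) (TruncPoly k p)

/-- The derivation `D` of `k[X]/(X^p)` induced by `d/dX`. -/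
def D [CharP k p] : W1 k p :=
  Derivation.liftOfSurjective (f := Ideal.Quotient.mkₐ k (Ideal.span {(X : k[X]) ^ p}))
    (Ideal.Quotient.mkₐ_surjective k _) (d := Polynomial.derivative')
    (by
      intro f hf
      rw [Ideal.Quotient.mkₐ_eq_mk, Ideal.Quotient.eq_zero_iff_mem,
        Ideal.mem_span_singleton] at hf ⊢
      obtain ⟨g, rfl⟩ := hf
      refine ⟨derivative g, ?_⟩
      simp [Polynomial.derivative'])

/-- `D X^i = i X^(i-1)`. -/
theorem D_x_pow [CharP k p] (i : ℕ) :
    D k p (x k p ^ i) = (i : TruncPoly k p) * x k p ^ (i - 1) := by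
  have h := Derivation.liftOfSurjective_apply
    (f := Ideal.Quotient.mkₐ k (Ideal.span {(X : k[X]) ^ p}))
    (Ideal.Quotient.mkₐ_surjective k _) (d := Polynomial.derivative')
    (by
      intro f hf
      rw [Ideal.Quotient.mkₐ_eq_mk, Ideal.Quotient.eq_zero_iff_mem,
        Ideal.mem_span_singleton] at hf ⊢
      obtain ⟨g, rfl⟩ := hf
      refine ⟨derivative g, ?_⟩
      simp [Polynomial.derivative']) ((X : k[X]) ^ i)
  simpa [D, x, Polynomial.derivative', Polynomial.derivative_X_pow] using h

/-- The term `𝔤_i`, `i ≥ 0`, of the natural filtration: the span of the `X^(j+1) D`, `j ≥ i`. -/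
def filtration [CharP k p] (i : ℕ) : Submodule k (W1 k p) :=
  Submodule.span k {d | ∃ j, i ≤ j ∧ d = x k p ^ (j + 1) • D k p}

/-- The `[p]`-th power of a derivation, as an endomorphism: its `p`-fold composite. -/
def pPower (d : W1 k p) : Module.End k (TruncPoly k p) :=
  (d : TruncPoly k p →ₗ[k] TruncPoly k p) ^ p

/-- The standard Borel subalgebra `𝓑⁺ = 𝔤_0`. -/
def borelPlus [CharP k p] : Submodule k (W1 k p) := filtration k p 0

/-- The nilpotent variety of the standard Borel subalgebra `𝓑⁺`. -/
def nilpotentVariety [CharP k p] : Set (W1 k p) :=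
  {d | d ∈ borelPlus k p ∧ pPower k p d = 0}

/-- The nilpotent commuting variety of the standard Borel subalgebra `𝓑⁺`. -/
def nilpotentCommutingVariety [CharP k p] : Set (W1 k p × W1 k p) :=
  {z | z.1 ∈ nilpotentVariety k p ∧ z.2 ∈ nilpotentVariety k p ∧ ⁅z.1, z.2⁆ = 0}

end WittAlg

end

open Polynomial

noncomputable section

/-! ### Regular functions and components of cones -/

section Cones

variable {k : Type*} [Field k] {V : Type*} [AddCommGroup V] [Module k V] {Z : Set V}

/-! Every derivation is `f D`, and `[f D, g D] = (f g' - g f') D`, so commuting means that a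
Wronskian vanishes mod `X ^ p`. If `f` has order exactly 2, subtract from `g` the multiple of `f`
with the same `X ^ 2` coefficient. A remainder of order `n` with `3 ≤ n ≤ p - 2` would give the
Wronskian a nonzero term in degree `n + 1 < p`, with factor `n - 2`. Hence `g` is proportional to
`f` mod `X ^ (p - 1)`, and the minors of their coefficients in degrees up to `p - 2` vanish
(`coeff_mul_coeff_eq`). Yet `X ^ 3 D` and `X ^ (p - 2) D` commute and have a nonzero minor. So the
`X ^ 2` coefficient of `f` times this minor is zero, with neither factor zero
(`exists_zero_divisors`).

The variety is a cone, and regular functions on it are polynomial along lines through the vertex.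
Hence nonzero functions keep nonzero germs at the origin, whose local ring is then not a domain. The
same principle makes the union of all scalings of a component irreducible, so that every component
contains the origin. -/

theorem linear_mem_coordinateRing (φ : Module.Dual k V) :
    (fun z : Z => φ (z : V)) ∈ coordinateRing k Z :=
  Algebra.subset_adjoin ⟨φ, rfl⟩

theorem minor_mem_coordinateRing (φ₁ φ₂ ψ₁ ψ₂ : Module.Dual k V) :
    (fun z : Z => φ₁ (z : V) * ψ₂ (z : V) - φ₂ (z : V) * ψ₁ (z : V)) ∈ coordinateRing k Z :=
  (coordinateRing k Z).sub_mem
    ((coordinateRing k Z).mul_mem (linear_mem_coordinateRing φ₁) (linear_mem_coordinateRing ψ₂))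
    ((coordinateRing k Z).mul_mem (linear_mem_coordinateRing φ₂) (linear_mem_coordinateRing ψ₁))

theorem smul_mem_coordinateRing (hZ : ∀ (t : k), ∀ z ∈ Z, t • z ∈ Z) (t : k) {f : Z → k}
    (hf : f ∈ coordinateRing k Z) :
    (fun z : Z => f ⟨t • (z : V), hZ t z z.2⟩) ∈ coordinateRing k Z := by
  induction hf using Algebra.adjoin_induction with
  | mem f hf =>
    obtain ⟨φ, rfl⟩ := hf
    simpa [Pi.smul_def] using
      (coordinateRing k Z).smul_mem (linear_mem_coordinateRing (Z := Z) φ) t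
  | algebraMap r => exact (coordinateRing k Z).algebraMap_mem r
  | add f g _ _ hf hg => exact (coordinateRing k Z).add_mem hf hg
  | mul f g _ _ hf hg => exact (coordinateRing k Z).mul_mem hf hg

/-- A regular function on a cone is polynomial along each line through the vertex. -/
theorem exists_polynomial_on_line (hZ : ∀ (t : k), ∀ z ∈ Z, t • z ∈ Z) (z : Z) {f : Z → k}
    (hf : f ∈ coordinateRing k Z) :
    ∃ P : k[X], ∀ t : k, f ⟨t • (z : V), hZ t z z.2⟩ = P.eval t := by
  induction hf using Algebra.adjoin_induction with
  | mem f hf =>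
    obtain ⟨φ, rfl⟩ := hf
    exact ⟨X * C (φ z), fun t => by simp only [map_smul, smul_eq_mul, eval_mul, eval_X, eval_C]⟩
  | algebraMap r => exact ⟨C r, fun t => by simp [Pi.algebraMap_apply]⟩
  | add f g _ _ hf hg =>
    obtain ⟨P, hP⟩ := hf
    obtain ⟨Q, hQ⟩ := hg
    exact ⟨P + Q, fun t => by simp [hP, hQ]⟩
  | mul f g _ _ hf hg =>
    obtain ⟨P, hP⟩ := hf
    obtain ⟨Q, hQ⟩ := hg
    exact ⟨P * Q, fun t => by simp [hP, hQ]⟩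

/-- On a line through the vertex of a cone, the non-vanishing loci of two regular functions
meet as soon as both are nonempty. -/
theorem exists_smul_ne_zero [Infinite k] (hZ : ∀ (t : k), ∀ z ∈ Z, t • z ∈ Z) (z : Z)
    {f g : Z → k} (hf : f ∈ coordinateRing k Z) (hg : g ∈ coordinateRing k Z) {s t : k}
    (hs : f ⟨s • (z : V), hZ s z z.2⟩ ≠ 0) (ht : g ⟨t • (z : V), hZ t z z.2⟩ ≠ 0) :
    ∃ r : k, f ⟨r • (z : V), hZ r z z.2⟩ ≠ 0 ∧ g ⟨r • (z : V), hZ r z z.2⟩ ≠ 0 := by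
  obtain ⟨P, hP⟩ := exists_polynomial_on_line hZ z hf
  obtain ⟨Q, hQ⟩ := exists_polynomial_on_line hZ z hg
  by_contra! h
  have hPQ : P * Q = 0 := Polynomial.funext fun r => by
    rw [eval_mul, eval_zero, ← hP, ← hQ]
    by_cases h0 : f ⟨r • (z : V), hZ r z z.2⟩ = 0
    · rw [h0, zero_mul]
    · rw [h r h0, mul_zero]
  rcases mul_eq_zero.1 hPQ with h0 | h0
  · exact hs (by rw [hP, h0, eval_zero])
  · exact ht (by rw [hQ, h0, eval_zero])

variable (k Z) in
theorem isTopologicalBasis_zariski :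
    @TopologicalSpace.IsTopologicalBasis Z (zariskiTopology k Z)
      {U | ∃ f ∈ coordinateRing k Z, U = {z : Z | f z ≠ 0}} := by
  let := zariskiTopology k Z
  refine ⟨?_, ?_, rfl⟩
  · rintro _ ⟨f, hf, rfl⟩ _ ⟨g, hg, rfl⟩ z hz
    have hfg : {w : Z | (f * g) w ≠ 0} = {w : Z | f w ≠ 0} ∩ {w : Z | g w ≠ 0} := by
      ext w
      simp
    exact ⟨_, ⟨f * g, (coordinateRing k Z).mul_mem hf hg, rfl⟩, hfg ▸ hz, hfg.subset⟩
  · refine Set.eq_univ_of_forall fun z => ?_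
    exact ⟨_, ⟨1, (coordinateRing k Z).one_mem, rfl⟩, by simp⟩

theorem isOpen_ne_zero {f : Z → k} (hf : f ∈ coordinateRing k Z) :
    @IsOpen Z (zariskiTopology k Z) {z : Z | f z ≠ 0} :=
  TopologicalSpace.isOpen_generateFrom_of_mem ⟨f, hf, rfl⟩

theorem continuous_smul_zariski (hZ : ∀ (t : k), ∀ z ∈ Z, t • z ∈ Z) (t : k) :
    @Continuous Z Z (zariskiTopology k Z) (zariskiTopology k Z)
      fun z => ⟨t • (z : V), hZ t z z.2⟩ := by
  let := zariskiTopology k Z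
  refine continuous_generateFrom_iff.2 ?_
  rintro _ ⟨f, hf, rfl⟩
  exact isOpen_ne_zero (smul_mem_coordinateRing hZ t hf)

/-- Every irreducible component of a cone contains the vertex. -/
theorem exists_eq_zero_of_mem_zariskiComponents [Infinite k]
    (hZ : ∀ (t : k), ∀ z ∈ Z, t • z ∈ Z) {Y : Set Z} (hY : Y ∈ zariskiComponents k Z) :
    ∃ z ∈ Y, (z : V) = 0 := by
  let := zariskiTopology k Z
  have hY' : Maximal IsIrreducible Y := hY
  let m : k → Z → Z := fun t z => ⟨t • (z : V), hZ t z z.2⟩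
  have hm : ∀ t, Continuous (m t) := continuous_smul_zariski hZ
  obtain ⟨y₀, hy₀⟩ := hY'.prop.nonempty
  have hsub : Y ⊆ {w | ∃ t, ∃ y ∈ Y, w = m t y} := fun y hy =>
    ⟨1, y, hy, Subtype.ext (one_smul k (y : V)).symm⟩
  have hirr : IsIrreducible {w | ∃ t, ∃ y ∈ Y, w = m t y} := by
    refine ⟨⟨y₀, hsub hy₀⟩, ?_⟩
    rintro A B hA hB ⟨_, ⟨s, a, ha, rfl⟩, hsA⟩ ⟨_, ⟨t, b, hb, rfl⟩, htB⟩
    -- Irreducibility of `Y` puts both scaled points on the line through one `y`; a single scalar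
    -- `r` is then found on that line.
    obtain ⟨y, hy, hyA, hyB⟩ := hY'.prop.isPreirreducible _ _ (hA.preimage (hm s))
      (hB.preimage (hm t)) ⟨a, ha, hsA⟩ ⟨b, hb, htB⟩
    obtain ⟨_, ⟨f, hf, rfl⟩, hfy, hfA⟩ :=
      (isTopologicalBasis_zariski k Z).exists_subset_of_mem_open (show m s y ∈ A from hyA) hA
    obtain ⟨_, ⟨g, hg, rfl⟩, hgy, hgB⟩ :=
      (isTopologicalBasis_zariski k Z).exists_subset_of_mem_open (show m t y ∈ B from hyB) hB
    obtain ⟨r, hr⟩ := exists_smul_ne_zero hZ y hf hg hfy hgy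
    exact ⟨m r y, ⟨r, y, hy, rfl⟩, hfA hr.1, hgB hr.2⟩
  exact ⟨m 0 y₀, hY'.le_of_ge hirr hsub ⟨0, y₀, hy₀, rfl⟩, zero_smul k (y₀ : V)⟩

/-- A variety whose coordinate ring has zero divisors is reducible. -/
theorem nontrivial_zariskiComponents {f g : Z → k} (hf : f ∈ coordinateRing k Z)
    (hg : g ∈ coordinateRing k Z) (hf0 : f ≠ 0) (hg0 : g ≠ 0) (hfg : f * g = 0) :
    (zariskiComponents k Z).Nontrivial := by
  let := zariskiTopology k Z
  obtain ⟨a, ha⟩ := Function.ne_iff.1 hf0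
  obtain ⟨b, hb⟩ := Function.ne_iff.1 hg0
  have hmem : ∀ z : Z, irreducibleComponent z ∈ zariskiComponents k Z :=
    irreducibleComponent_mem_irreducibleComponents
  refine ⟨_, hmem a, _, hmem b, fun h => ?_⟩
  obtain ⟨z, -, hzf, hzg⟩ := (isIrreducible_irreducibleComponent (x := a)).isPreirreducible _ _
    (isOpen_ne_zero hf) (isOpen_ne_zero hg) ⟨a, mem_irreducibleComponent, ha⟩
    ⟨b, h ▸ mem_irreducibleComponent, hb⟩
  exact mul_ne_zero hzf hzg (congrFun hfg z)

/-- A nonzero regular function on a cone has nonzero germ at the vertex. -/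
theorem algebraMap_localRingAt_ne_zero [Infinite k] (hZ : ∀ (t : k), ∀ z ∈ Z, t • z ∈ Z)
    {o : Z} (ho : (o : V) = 0) {f : coordinateRing k Z} (hf : f ≠ 0) :
    algebraMap (coordinateRing k Z) (localRingAt k Z o) f ≠ 0 := by
  intro h
  obtain ⟨⟨s, hs⟩, hsf⟩ :=
    (IsLocalization.map_eq_zero_iff (pointIdeal k Z o).primeCompl (localRingAt k Z o) f).1 h
  have hs' : (s : Z → k) o ≠ 0 := hs
  obtain ⟨a, ha⟩ := Function.ne_iff.1 fun h' : (f : Z → k) = 0 => hf (Subtype.ext h')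
  have h1 : (⟨(1 : k) • (a : V), hZ 1 a a.2⟩ : Z) = a := Subtype.ext (one_smul k (a : V))
  have h0 : (⟨(0 : k) • (a : V), hZ 0 a a.2⟩ : Z) = o :=
    Subtype.ext ((zero_smul k (a : V)).trans ho.symm)
  -- The annihilator `s` is nonzero at the vertex (scalar 0) and `f` at `a` (scalar 1), so both are
  -- nonzero somewhere on this line.
  obtain ⟨r, hr, hr'⟩ := exists_smul_ne_zero hZ a s.2 f.2 (s := 0) (t := 1)
    (by rwa [h0]) (by rwa [h1])
  exact mul_ne_zero hr hr' (congrFun (congrArg Subtype.val hsf) _)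

/-- A cone whose coordinate ring has zero divisors is not normal at the vertex. -/
theorem not_isNormalVariety [Infinite k] (hZ : ∀ (t : k), ∀ z ∈ Z, t • z ∈ Z)
    {f g : Z → k} (hf : f ∈ coordinateRing k Z) (hg : g ∈ coordinateRing k Z)
    (hf0 : f ≠ 0) (hg0 : g ≠ 0) (hfg : f * g = 0) : ¬ IsNormalVariety k Z := by
  intro hN
  obtain ⟨a, -⟩ := Function.ne_iff.1 hf0
  let o : Z := ⟨(0 : k) • (a : V), hZ 0 a a.2⟩
  have ho : (o : V) = 0 := zero_smul k (a : V)
  have := (hN o).1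
  let F : coordinateRing k Z := ⟨f, hf⟩
  let G : coordinateRing k Z := ⟨g, hg⟩
  have hF : F ≠ 0 := fun h => hf0 (congrArg Subtype.val h)
  have hG : G ≠ 0 := fun h => hg0 (congrArg Subtype.val h)
  have hFG : F * G = 0 := Subtype.ext hfg
  refine mul_ne_zero (algebraMap_localRingAt_ne_zero hZ ho hF)
    (algebraMap_localRingAt_ne_zero hZ ho hG) ?_
  rw [← map_mul, hFG, map_zero]

end Cones

/-! ### Derivations of the truncated polynomial algebra -/

namespace WittAlg

variable {k : Type*} [Field k] {p : ℕ}

theorem mk_eq_zero_iff {f : k[X]} :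
    (Ideal.Quotient.mk _ f : TruncPoly k p) = 0 ↔ (X : k[X]) ^ p ∣ f := by
  rw [Ideal.Quotient.eq_zero_iff_mem, Ideal.mem_span_singleton]

theorem derivation_ext {d e : W1 k p} (h : d (x k p) = e (x k p)) : d = e := by
  have htop : Algebra.adjoin k {x k p} = ⊤ :=
    AdjoinRoot.adjoinRoot_eq_top (f := (X : k[X]) ^ p)
  exact Derivation.ext_of_adjoin_eq_top {x k p} htop (Set.eqOn_singleton.2 h)

/-- The coefficient of `X ^ i`, `i < p`, as a linear form on the truncated polynomial algebra. -/
def coeffForm {i : ℕ} (hi : i < p) : TruncPoly k p →ₗ[k] k :=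
  Submodule.liftQ ((Ideal.span {(X : k[X]) ^ p}).restrictScalars k) (lcoeff k i) (by
    intro f hf
    rw [Submodule.restrictScalars_mem, Ideal.mem_span_singleton] at hf
    simpa using X_pow_dvd_iff.1 hf i hi)

/-- The coefficient of `X ^ i D` as a linear form on the Witt algebra. -/
def coord {i : ℕ} (hi : i < p) : W1 k p →ₗ[k] k where
  toFun d := coeffForm hi (d (x k p))
  map_add' d e := by rw [Derivation.add_apply, map_add]
  map_smul' c d := by rw [Derivation.smul_apply, map_smul, RingHom.id_apply]

variable [CharP k p]

theorem D_mk (f : k[X]) :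
    D k p (Ideal.Quotient.mk _ f) = Ideal.Quotient.mk _ (derivative f) := by
  unfold D
  exact Derivation.liftOfSurjective_apply
    (f := Ideal.Quotient.mkₐ k (Ideal.span {(X : k[X]) ^ p}))
    (Ideal.Quotient.mkₐ_surjective k _) (d := Polynomial.derivative') _ f

theorem D_x : D k p (x k p) = 1 := by
  simpa using D_x_pow k p 1

/-- The derivation `f D`. -/
def mkD (f : k[X]) : W1 k p := (Ideal.Quotient.mk _ f : TruncPoly k p) • D k p

theorem mkD_mk (f g : k[X]) :
    (mkD f : W1 k p) (Ideal.Quotient.mk _ g) = Ideal.Quotient.mk _ (f * derivative g) := by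
  rw [mkD, Derivation.smul_apply, D_mk, smul_eq_mul, map_mul]

theorem mkD_x (f : k[X]) : (mkD f : W1 k p) (x k p) = Ideal.Quotient.mk _ f := by
  rw [mkD, Derivation.smul_apply, D_x, smul_eq_mul, mul_one]

theorem exists_eq_mkD (d : W1 k p) : ∃ f : k[X], d = mkD f := by
  obtain ⟨f, hf⟩ := Ideal.Quotient.mk_surjective (d (x k p))
  exact ⟨f, derivation_ext (by rw [mkD_x, hf])⟩

theorem mkD_add (f g : k[X]) : (mkD (f + g) : W1 k p) = mkD f + mkD g := by
  rw [mkD, map_add, add_smul, mkD, mkD]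

theorem mkD_smul (c : k) (f : k[X]) : (mkD (c • f) : W1 k p) = c • mkD f :=
  derivation_ext (by rw [Derivation.smul_apply, mkD_x, mkD_x]; rfl)

theorem mkD_zero : (mkD 0 : W1 k p) = 0 :=
  derivation_ext (by rw [mkD_x, map_zero, Derivation.zero_apply])

theorem mkD_mem_filtration {i : ℕ} (f : k[X]) :
    (mkD (X ^ (i + 1) * f) : W1 k p) ∈ filtration k p i := by
  induction f using Polynomial.induction_on' with
  | add f g hf hg =>
    rw [mul_add, mkD_add]
    exact add_mem hf hg
  | monomial n c =>
    have h : (X : k[X]) ^ (i + 1) * monomial n c = c • X ^ (i + n + 1) := by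
      rw [← C_mul_X_pow_eq_monomial, smul_eq_C_mul]
      ring
    rw [h, mkD_smul]
    refine Submodule.smul_mem _ _ (Submodule.subset_span ⟨i + n, by lia, ?_⟩)
    rw [mkD, map_pow, x]

theorem mem_filtration_iff {i : ℕ} {d : W1 k p} :
    d ∈ filtration k p i ↔ ∃ f : k[X], d = mkD (X ^ (i + 1) * f) := by
  refine ⟨fun h => ?_, ?_⟩
  · induction h using Submodule.span_induction with
    | mem d hd =>
      obtain ⟨j, hj, rfl⟩ := hd
      refine ⟨X ^ (j - i), ?_⟩
      rw [← pow_add, show i + 1 + (j - i) = j + 1 by lia, mkD, map_pow, x]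
    | zero => exact ⟨0, by rw [mul_zero, mkD_zero]⟩
    | add d e _ _ hd he =>
      obtain ⟨f, rfl⟩ := hd
      obtain ⟨g, rfl⟩ := he
      exact ⟨f + g, by rw [mul_add, mkD_add]⟩
    | smul c d _ hd =>
      obtain ⟨f, rfl⟩ := hd
      exact ⟨c • f, by rw [mul_smul_comm, mkD_smul]⟩
  · rintro ⟨f, rfl⟩
    exact mkD_mem_filtration f

/-- Each application of `X ^ 2 f D` raises the order by at least one, so the `p`-th power is zero.
-/
theorem filtration_one_iterate (f g : k[X]) (n : ℕ) :
    ∃ h : k[X], (((mkD (X ^ 2 * f) : W1 k p) : TruncPoly k p →ₗ[k] TruncPoly k p) ^ n)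
      (Ideal.Quotient.mk _ g) = Ideal.Quotient.mk _ (X ^ n * h) := by
  induction n with
  | zero => exact ⟨g, by simp⟩
  | succ n ih =>
    obtain ⟨h, hh⟩ := ih
    refine ⟨f * (C (n : k) * h + X * derivative h), ?_⟩
    rw [pow_succ', Module.End.mul_apply, hh]
    refine (mkD_mk _ _).trans (congrArg _ ?_)
    -- The derivative of `X ^ n` involves the truncated exponent `n - 1`, so `n = 0` is separate.
    rcases n with _ | n
    · simp
      ring
    · simp [derivative_mul]
      ring

/-- `X f D` acts on `(X)/(X ^ 2)` by the scalar `f(0)`; nilpotency therefore forces `f(0) = 0`. -/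
theorem filtration_zero_iterate (f : k[X]) (n : ℕ) :
    ∃ h : k[X], (((mkD (X * f) : W1 k p) : TruncPoly k p →ₗ[k] TruncPoly k p) ^ n)
      (x k p) = Ideal.Quotient.mk _ (X * h) ∧ h.coeff 0 = f.coeff 0 ^ n := by
  induction n with
  | zero => exact ⟨1, by simp [x], by simp⟩
  | succ n ih =>
    obtain ⟨h, hh, h0⟩ := ih
    refine ⟨f * (h + X * derivative h), ?_, ?_⟩
    · rw [pow_succ', Module.End.mul_apply, hh]
      refine (mkD_mk _ _).trans (congrArg _ ?_)
      simp [derivative_mul]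
      ring
    · simp [mul_coeff_zero, h0, pow_succ']

theorem nilpotentVariety_eq (hp : 1 < p) :
    nilpotentVariety k p = (filtration k p 1 : Set (W1 k p)) := by
  ext d
  constructor
  · rintro ⟨hd, hpow⟩
    obtain ⟨f, rfl⟩ := mem_filtration_iff.1 hd
    rw [zero_add, pow_one] at hpow ⊢
    obtain ⟨h, hh, h0⟩ := filtration_zero_iterate (p := p) f p
    have hz : (Ideal.Quotient.mk _ (X * h) : TruncPoly k p) = 0 := by
      rw [← hh]
      exact congrArg (fun e : Module.End k (TruncPoly k p) => e (x k p)) hpow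
    have hc : h.coeff 0 = 0 := by
      simpa using X_pow_dvd_iff.1 (mk_eq_zero_iff.1 hz) 1 hp
    obtain ⟨g, rfl⟩ := X_dvd_iff.2 (pow_eq_zero_iff (by lia) |>.1 (h0.symm.trans hc))
    exact mem_filtration_iff.2 ⟨g, by rw [← mul_assoc, ← sq]⟩
  · intro hd
    obtain ⟨f, rfl⟩ := mem_filtration_iff.1 hd
    refine ⟨mem_filtration_iff.2 ⟨X * f, by ring_nf⟩, LinearMap.ext fun a => ?_⟩
    obtain ⟨g, rfl⟩ := Ideal.Quotient.mk_surjective a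
    obtain ⟨h, hh⟩ := filtration_one_iterate (p := p) f g p
    exact hh.trans (mk_eq_zero_iff.2 (dvd_mul_right _ _))

/-! ### Commuting pairs and Wronskians -/

theorem lie_mkD_eq_zero_iff (f g : k[X]) :
    ⁅(mkD f : W1 k p), mkD g⁆ = 0 ↔ (X : k[X]) ^ p ∣ f * derivative g - g * derivative f := by
  rw [← mk_eq_zero_iff]
  have h : ⁅(mkD f : W1 k p), mkD g⁆ (x k p) =
      Ideal.Quotient.mk _ (f * derivative g - g * derivative f) := by
    rw [Derivation.commutator_apply, mkD_x, mkD_x, mkD_mk, mkD_mk, map_sub]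
  rw [← h]
  exact ⟨fun h => by rw [h]; rfl, fun h => derivation_ext h⟩

/-- If `f` has order `2` and `w` has order at least `3`, then `f D` and `w D` commute only if
`w` has order at least `p - 1`. -/
theorem X_pow_dvd_of_wronskian {f w : k[X]} (hf : X ^ 2 ∣ f) (hf2 : f.coeff 2 ≠ 0)
    (hw : X ^ 3 ∣ w) (h : X ^ p ∣ f * derivative w - w * derivative f) {n : ℕ} (hn : n < p) :
    X ^ n ∣ w := by
  induction n with
  | zero => simp
  | succ n ih =>
    specialize ih (by lia)
    rcases lt_or_ge n 3 with h3 | h3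
    · exact (pow_dvd_pow X h3).trans hw
    obtain ⟨m, rfl⟩ := Nat.exists_eq_add_of_le h3
    obtain ⟨U, rfl⟩ := hf
    obtain ⟨W, rfl⟩ := ih
    have hexp : X ^ 2 * U * derivative (X ^ (3 + m) * W) -
        X ^ (3 + m) * W * derivative (X ^ 2 * U) =
        X ^ (m + 4) * (C ((m + 1 : ℕ) : k) * (U * W) +
          X * (U * derivative W - W * derivative U)) := by
      simp only [derivative_mul, derivative_X_pow, map_natCast]
      rw [show 3 + m - 1 = m + 2 by lia]
      push_cast
      ring
    rw [hexp] at h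
    -- The lowest coefficient is `(m + 1) U(0) W(0)`, where `m + 1` is the difference of the orders
    -- `3 + m` and `2`, invertible because `0 < m + 1 < p`.
    have hc := X_pow_dvd_iff.1 h (m + 4) (by lia)
    rw [show m + 4 = 0 + (m + 4) by lia, zero_add, coeff_X_pow_mul'] at hc
    have hU : U.coeff 0 ≠ 0 := by simpa [coeff_X_pow_mul'] using hf2
    have hm : (m : k) + 1 ≠ 0 := by
      rw [← Nat.cast_succ, Ne, CharP.cast_eq_zero_iff k p]
      exact fun hd => absurd (Nat.le_of_dvd (by lia) hd) (by lia)
    have hW : W.coeff 0 = 0 := by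
      simp only [le_refl, if_true, tsub_self, coeff_add, mul_coeff_zero,
        coeff_X_zero, zero_mul, add_zero] at hc
      simpa [hm, hU] using hc
    rw [pow_succ]
    exact mul_dvd_mul_left _ (X_dvd_iff.2 hW)

/-- Replacing `g` by `g - c f` leaves the Wronskian unchanged, and the right `c` raises the order to
3. Degree `p - 1` is excluded: a term `X ^ (p - 1)` in `g` only affects the Wronskian from degree
`p` on. -/
theorem coeff_mul_coeff_eq {f g : k[X]} (hf : X ^ 2 ∣ f) (hg : X ^ 2 ∣ g) (hf2 : f.coeff 2 ≠ 0)
    (h : X ^ p ∣ f * derivative g - g * derivative f) {i j : ℕ} (hi : i + 1 < p)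
    (hj : j + 1 < p) : f.coeff i * g.coeff j = f.coeff j * g.coeff i := by
  set c := g.coeff 2 / f.coeff 2 with hc
  have hw : X ^ 3 ∣ g - C c * f := by
    refine X_pow_dvd_iff.2 fun m hm => ?_
    rw [coeff_sub, coeff_C_mul]
    rcases Nat.lt_succ_iff_lt_or_eq.1 hm with hm | rfl
    · rw [X_pow_dvd_iff.1 hf m hm, X_pow_dvd_iff.1 hg m hm, mul_zero, sub_zero]
    · rw [hc, div_mul_cancel₀ _ hf2, sub_self]
  have hwr : f * derivative (g - C c * f) - (g - C c * f) * derivative f =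
      f * derivative g - g * derivative f := by
    simp only [derivative_sub, derivative_C_mul]
    ring
  have hd : X ^ (p - 1) ∣ g - C c * f :=
    X_pow_dvd_of_wronskian hf hf2 hw (hwr ▸ h) (by lia)
  have hcoeff : ∀ m, m + 1 < p → g.coeff m = c * f.coeff m := fun m hm => by
    simpa [sub_eq_zero] using X_pow_dvd_iff.1 hd m (by lia)
  rw [hcoeff i hi, hcoeff j hj]
  ring

theorem coord_mkD {i : ℕ} (hi : i < p) (f : k[X]) : coord hi (mkD f : W1 k p) = f.coeff i := by
  change coeffForm hi ((mkD f : W1 k p) (x k p)) = _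
  rw [mkD_x]
  rfl

/-! ### Zero divisors on the nilpotent commuting variety -/

theorem mem_nilpotentCommutingVariety_iff (hp : 1 < p) {z : W1 k p × W1 k p} :
    z ∈ nilpotentCommutingVariety k p ↔
      ∃ f g : k[X], X ^ 2 ∣ f ∧ X ^ 2 ∣ g ∧ X ^ p ∣ f * derivative g - g * derivative f ∧
        z = (mkD f, mkD g) := by
  obtain ⟨d, e⟩ := z
  simp only [nilpotentCommutingVariety, nilpotentVariety_eq hp, Set.mem_ofPred_eq,
    SetLike.mem_coe, mem_filtration_iff]
  constructor
  · rintro ⟨⟨f, rfl⟩, ⟨g, rfl⟩, h⟩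
    exact ⟨_, _, dvd_mul_right _ _, dvd_mul_right _ _, (lie_mkD_eq_zero_iff _ _).1 h, rfl⟩
  · rintro ⟨_, _, ⟨f, rfl⟩, ⟨g, rfl⟩, h, heq⟩
    obtain ⟨rfl, rfl⟩ := Prod.mk.inj heq
    exact ⟨⟨f, rfl⟩, ⟨g, rfl⟩, (lie_mkD_eq_zero_iff _ _).2 h⟩

theorem smul_mem_nilpotentCommutingVariety (hp : 1 < p) (t : k) (z : W1 k p × W1 k p)
    (hz : z ∈ nilpotentCommutingVariety k p) : t • z ∈ nilpotentCommutingVariety k p := by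
  rw [mem_nilpotentCommutingVariety_iff hp] at hz ⊢
  obtain ⟨f, g, hf, hg, h, rfl⟩ := hz
  refine ⟨t • f, t • g, dvd_smul_of_dvd t hf, dvd_smul_of_dvd t hg, ?_, ?_⟩
  · have : t • f * derivative (t • g) - t • g * derivative (t • f) =
        t • t • (f * derivative g - g * derivative f) := by
      simp only [derivative_smul, smul_mul_assoc, mul_smul_comm, smul_sub]
    rw [this]
    exact dvd_smul_of_dvd _ (dvd_smul_of_dvd _ h)
  · rw [mkD_smul, mkD_smul, Prod.smul_mk]

theorem exists_coeff_fst {i : ℕ} (hi : i < p) :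
    ∃ a : Module.Dual k (W1 k p × W1 k p), ∀ f g : k[X], a (mkD f, mkD g) = f.coeff i :=
  ⟨(coord hi).comp (LinearMap.fst k _ _), fun f _ => coord_mkD hi f⟩

theorem exists_coeff_snd {i : ℕ} (hi : i < p) :
    ∃ b : Module.Dual k (W1 k p × W1 k p), ∀ f g : k[X], b (mkD f, mkD g) = g.coeff i :=
  ⟨(coord hi).comp (LinearMap.snd k _ _), fun _ g => coord_mkD hi g⟩

/-- For `p > 5` the coordinate ring of the nilpotent commuting variety has zero divisors: the
`X ^ 2 D`-coordinate of the first component, and a minor which vanishes where it does not. -/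
theorem exists_zero_divisors (hp : 6 < p) :
    ∃ f ∈ coordinateRing k (nilpotentCommutingVariety k p),
      ∃ g ∈ coordinateRing k (nilpotentCommutingVariety k p), f ≠ 0 ∧ g ≠ 0 ∧ f * g = 0 := by
  have hmem := fun z => mem_nilpotentCommutingVariety_iff (k := k) (p := p) (z := z) (by lia)
  obtain ⟨a₂, ha₂⟩ := exists_coeff_fst (k := k) (p := p) (i := 2) (by lia)
  obtain ⟨a₃, ha₃⟩ := exists_coeff_fst (k := k) (p := p) (i := 3) (by lia)
  obtain ⟨b₃, hb₃⟩ := exists_coeff_snd (k := k) (p := p) (i := 3) (by lia)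
  obtain ⟨a, ha⟩ := exists_coeff_fst (k := k) (p := p) (i := p - 2) (by lia)
  obtain ⟨b, hb⟩ := exists_coeff_snd (k := k) (p := p) (i := p - 2) (by lia)
  refine ⟨_, linear_mem_coordinateRing a₂, _,
    minor_mem_coordinateRing a₃ a b₃ b, fun h => ?_, fun h => ?_, ?_⟩
  · have hz : (mkD (X ^ 2), mkD 0) ∈ nilpotentCommutingVariety k p :=
      (hmem _).2 ⟨_, _, dvd_rfl, dvd_zero _, by simp, rfl⟩
    have h0 : a₂ (mkD (X ^ 2), mkD 0) = 0 := congrFun h ⟨_, hz⟩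
    rw [ha₂, coeff_X_pow_self] at h0
    exact one_ne_zero h0
  -- The exponents 3 and `p - 2` add up to `p + 1`, so the Wronskian is a multiple of `X ^ p`.
  · have hz : (mkD (X ^ 3), mkD (X ^ (p - 2))) ∈ nilpotentCommutingVariety k p := by
      refine (hmem _).2 ⟨_, _, pow_dvd_pow X (by lia), pow_dvd_pow X (by lia), ?_, rfl⟩
      obtain ⟨m, rfl⟩ := Nat.exists_eq_add_of_le (show 3 ≤ p by lia)
      have : (X : k[X]) ^ 3 * derivative (X ^ (3 + m - 2)) -
          X ^ (3 + m - 2) * derivative (X ^ 3) = X ^ (3 + m) * (C (m : k) - 2) := by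
        simp only [derivative_X_pow]
        rw [show 3 + m - 2 = m + 1 by lia]
        push_cast
        simp only [map_add, map_natCast, map_one, map_ofNat]
        ring
      rw [this]
      exact dvd_mul_right _ _
    have h0 : a₃ (mkD (X ^ 3), mkD (X ^ (p - 2))) * b (mkD (X ^ 3), mkD (X ^ (p - 2))) -
        a (mkD (X ^ 3), mkD (X ^ (p - 2))) * b₃ (mkD (X ^ 3), mkD (X ^ (p - 2))) = 0 :=
      congrFun h ⟨_, hz⟩
    -- The minor equals 1 because `p - 2 ≠ 3`; for `p = 5` the two columns would coincide.
    rw [ha₃, hb, ha, hb₃, coeff_X_pow_self, coeff_X_pow_self, coeff_X_pow,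
      if_neg (show p - 2 ≠ 3 by lia), zero_mul, one_mul, sub_zero] at h0
    exact one_ne_zero h0
  · funext ⟨z, hz⟩
    obtain ⟨f, g, hf, hg, h, rfl⟩ := (hmem z).1 hz
    rw [Pi.mul_apply, Pi.zero_apply, ha₂, ha₃, hb, ha, hb₃]
    by_cases hf2 : f.coeff 2 = 0
    · rw [hf2, zero_mul]
    · rw [coeff_mul_coeff_eq hf hg hf2 h (i := 3) (j := p - 2) (by lia) (by lia), sub_self,
        mul_zero]

end WittAlg

end

theorem corollary2 {k : Type*} [Field k] [IsAlgClosed k] (p : ℕ) [Fact p.Prime] [CharP k p]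
    (hp : 5 < p) :
    WittAlg.nilpotentVariety k p = (WittAlg.filtration k p 1 : Set (WittAlg.W1 k p)) ∧
    ¬ IsNormalVariety k (WittAlg.nilpotentCommutingVariety k p) ∧
    (zariskiComponents k (WittAlg.nilpotentCommutingVariety k p)).Nontrivial ∧
    ∀ Y ∈ zariskiComponents k (WittAlg.nilpotentCommutingVariety k p),
      ∃ z ∈ Y, (z : WittAlg.W1 k p × WittAlg.W1 k p) = (0, 0) := by
  have hp' : 6 < p := by
    refine lt_of_le_of_ne hp fun h => ?_
    have h6 : Nat.Prime 6 := h ▸ (Fact.out : p.Prime)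
    exact absurd h6 (by norm_num)
  have : Infinite k := IsAlgClosed.instInfinite
  have hZ := WittAlg.smul_mem_nilpotentCommutingVariety (k := k) (p := p) (by lia)
  obtain ⟨f, hf, g, hg, hf0, hg0, hfg⟩ := WittAlg.exists_zero_divisors (k := k) hp'
  exact ⟨WittAlg.nilpotentVariety_eq (by lia), not_isNormalVariety hZ hf hg hf0 hg0 hfg,
    nontrivial_zariskiComponents hf hg hf0 hg0 hfg,
    fun Y hY => exists_eq_zero_of_mem_zariskiComponents hZ hY⟩
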